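/- There are absolute constants $a,b,C>0$ such that for every integer $d\ge 1$ there is a constant $c_d\ge 1$, depending only on $d$ and satisfying $c_d>1$ whenever $d\ge 2$, such that for every integer $n\ge 1$ there is a finite abstract simplicial complex $\mathcal{B}_d^n$ of dimension $d$ with the following properties. The number $n_d$ of $d$-simplices (faces with $d+1$ vertices) of $\mathcal{B}_d^n$ satisfies $$a\,(d+1)^3 n\;\le\; n_d\;\le\; b\,(d+1)^3 n ,$$ that is, $n_d\in\Theta((d+1)^3 n)$; and the spectral gaps of $L_{d-1}[\mathcal{B}_d^n]$ and of $L_d[\mathcal{B}_d^n]$ exist and satisfy $$\lambda_{\min}\bigl(L_{d-1}[\mathcal{B}_d^n]\bigr)\le \frac{C}{c_d^{\,n_d}},\qquad \lambda_{\min}\bigl(L_{d}[\mathcal{B}_d^n]\bigr)\le \frac{C}{c_d^{\,n_d}} ,$$ that is, they are $O(1/c_d^{n_d})$. Here, for a finite simplicial complex $\mathcal{K}$ with a total order on its vertices, $C_k(\mathcal{K})$ is the real vector space with orthonormal basis the $k$-simplices of $\mathcal{K}$; the boundary map $\partial_k:C_k(\mathcal{K})\to C_{k-1}(\mathcal{K})$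 for $k\ge1$ sends a simplex $\{v_0<\dots<v_k\}$ to $\sum_{j=0}^k(-1)^j\{v_0,\dots,v_k\}\setminus\{v_j\}$, and $\partial_0=0$; the combinatorial Laplacian is $L_k[\mathcal{K}]=\partial_{k+1}\partial_{k+1}^T+\partial_k^T\partial_k$; and the spectral gap $\lambda_{\min}(L_k)$ is its smallest non-zero eigenvalue. -/

import Mathlib

namespace PreAbstractSimplicialComplex

variable {V : Type*}

/-- The `k`-simplices of the complex `K`: its faces with exactly `k + 1` vertices. -/
def Simplex (K : PreAbstractSimplicialComplex V) (k : ℕ) : Type _ :=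
  {s : Finset V // s ∈ K ∧ s.card = k + 1}

noncomputable instance [Finite V] (K : PreAbstractSimplicialComplex V) (k : ℕ) :
    Fintype (K.Simplex k) :=
  haveI : Finite (K.Simplex k) :=
    inferInstanceAs (Finite {s : Finset V // s ∈ K ∧ s.card = k + 1})
  Fintype.ofFinite _

/-- The number `n_k` of `k`-simplices of `K`. -/
noncomputable def numSimplices (K : PreAbstractSimplicialComplex V) (k : ℕ) : ℕ :=
  Nat.card (K.Simplex k)

/-- `K` has dimension `d`: `d` is the largest `k` for which `K` has a `k`-simplex. -/
def HasDimension (K : PreAbstractSimplicialComplex V) (d : ℕ) : Prop :=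
  IsGreatest {k : ℕ | Nonempty (K.Simplex k)} d

/-- The matrix of the boundary map `∂_{k+1} : C_{k+1}(K) → C_k(K)` over `ℝ` in the bases of
simplices: the column of `σ = {v_0 < ⋯ < v_{k+1}}` is `∑_j (-1)^j (σ \ {v_j})`, where the index
`j` of a vertex `v = v_j` is the number of vertices of `σ` that are smaller than `v`. -/
noncomputable def boundary [LinearOrder V] (K : PreAbstractSimplicialComplex V) (k : ℕ) :
    Matrix (K.Simplex k) (K.Simplex (k + 1)) ℝ :=
  fun τ σ => ∑ v ∈ σ.1,
    if τ.1 = σ.1.erase v then (-1 : ℝ) ^ (σ.1.filter (fun w => w < v)).card else 0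

/-- The up Laplacian `L_k^{up} = ∂_{k+1} ∂_{k+1}ᵀ`. -/
noncomputable def upLaplacian [Finite V] [LinearOrder V] (K : PreAbstractSimplicialComplex V)
    (k : ℕ) : Matrix (K.Simplex k) (K.Simplex k) ℝ :=
  K.boundary k * (K.boundary k).transpose

/-- The down Laplacian `L_k^{down} = ∂_kᵀ ∂_k`, where `∂_0 = 0`. -/
noncomputable def downLaplacian [Finite V] [LinearOrder V] (K : PreAbstractSimplicialComplex V) :
    (k : ℕ) → Matrix (K.Simplex k) (K.Simplex k) ℝ
  | 0 => 0
  | k + 1 => (K.boundary k).transpose * K.boundary k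

/-- The combinatorial Laplacian `L_k = L_k^{up} + L_k^{down}`. -/
noncomputable def laplacian [Finite V] [LinearOrder V] (K : PreAbstractSimplicialComplex V)
    (k : ℕ) : Matrix (K.Simplex k) (K.Simplex k) ℝ :=
  K.upLaplacian k + K.downLaplacian k

end PreAbstractSimplicialComplex

/-- `g` is the spectral gap of the (positive semidefinite) real matrix `A`: its smallest non-zero
eigenvalue. In particular, a non-zero eigenvalue exists. -/
def IsSpectralGap {ι : Type*} [Fintype ι] (A : Matrix ι ι ℝ) (g : ℝ) : Prop :=
  IsLeast {μ : ℝ | μ ≠ 0 ∧ Module.End.HasEigenvalue A.mulVecLin μ} g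

/-! If a complex has dimension `d`, then `L_d = ∂_dᵀ ∂_d`. Moreover `∂_d` carries eigenvectors of
`∂_dᵀ ∂_d` with non-zero eigenvalue to eigenvectors of `L_{d-1}` with the same eigenvalue, because
`∂_{d-1} ∂_d = 0`. If in addition `∂_d` is injective, no eigenvalue of `L_d` vanishes, so the
Rayleigh quotient `|∂x|² / |x|²` of any chain `x ≠ 0` bounds both gaps (`exists_spectralGaps_le`).

For `d = 2`, glue `m` cylinders in which the circle `Z_{i+1}` is homologous to `2 Z_i`, and fill
`Z_0` with a triangle. Weighting cylinder `i` by `2^{-i}` makes the boundaries telescope to a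
multiple `2 · 2^{-m}` of `Z_m`, while the triangle keeps weight `2`; the quotient is at most `9 /
4^m`. The complex collapses from the side of `Z_m`, so it has no 2-cycles.

For `d > 2`, join with the boundary of a simplex. Joining with a cycle multiplies `|x|` and `|∂x|`
by the same factor, so the quotient is unchanged, and the collapse is inherited. The number of
facets is multiplied by `d - 1`, and `m = (d+1)² n` gives the required count. For `d = 1`, where
`c_1 = 1` is allowed, a star suffices. -/

open scoped Matrix

/-! ### Boundary operator on real functions of finite sets -/

/-- The simplicial boundary operator on real functions of finite sets of vertices; a function `x`
stands for the chain `∑ s, x s • s`, where the empty set counts as a simplex. -/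
noncomputable def chainBoundary (V : Type*) [Fintype V] [LinearOrder V] :
    (Finset V → ℝ) →ₗ[ℝ] (Finset V → ℝ) where
  toFun x s := ∑ v, if v ∈ s then 0 else (-1 : ℝ) ^ (s.filter (· < v)).card * x (insert v s)
  map_add' x y := by
    ext s
    simp only [Pi.add_apply, ← Finset.sum_add_distrib]
    refine Finset.sum_congr rfl fun v _ => ?_
    split_ifs <;> ring
  map_smul' r x := by
    ext s
    simp only [Pi.smul_apply, smul_eq_mul, RingHom.id_apply, Finset.mul_sum]
    refine Finset.sum_congr rfl fun v _ => ?_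
    split_ifs <;> ring

theorem neg_one_pow_card_filter_insert {V : Type*} [LinearOrder V] {s : Finset V} {u v : V} (hu : u ∉ s) :
    (-1 : ℝ) ^ ((insert u s).filter (· < v)).card =
      (if u < v then -1 else 1) * (-1 : ℝ) ^ (s.filter (· < v)).card := by
  rw [Finset.filter_insert]
  split_ifs with h
  · rw [Finset.card_insert_of_notMem (by simp [hu]), pow_succ]; ring
  · ring

section Boundary

variable {V : Type*} [Fintype V] [LinearOrder V]

theorem chainBoundary_apply (x : Finset V → ℝ) (s : Finset V) :
    chainBoundary V x s =
      ∑ v, if v ∈ s then 0 else (-1 : ℝ) ^ (s.filter (· < v)).card * x (insert v s) := rfl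

/-- Inserting `u` and `v` in the two possible orders gives opposite signs, since exactly one of `u <
v`, `v < u` holds. -/
theorem chainBoundary_chainBoundary (x : Finset V → ℝ) :
    chainBoundary V (chainBoundary V x) = 0 := by
  ext s
  set F : V → V → ℝ := fun u v =>
    if u ∈ s then 0 else (-1 : ℝ) ^ (s.filter (· < u)).card *
      (if v ∈ insert u s then 0 else
        (-1 : ℝ) ^ ((insert u s).filter (· < v)).card * x (insert v (insert u s))) with hF
  have hsum : chainBoundary V (chainBoundary V x) s = ∑ u, ∑ v, F u v := by
    rw [chainBoundary_apply]
    refine Finset.sum_congr rfl fun u _ => ?_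
    simp only [hF, chainBoundary_apply]
    split_ifs with h
    · simp
    · rw [Finset.mul_sum]
  have hanti : ∀ u v, F u v = - F v u := by
    intro u v
    simp only [hF]
    by_cases hu : u ∈ s
    · simp [hu]
    by_cases hv : v ∈ s
    · simp [hv]
    by_cases huv : u = v
    · subst huv; simp
    have hvu : v ≠ u := fun h => huv h.symm
    simp only [hu, hv, if_false, Finset.mem_insert, huv, hvu, or_self,
      neg_one_pow_card_filter_insert hu, neg_one_pow_card_filter_insert hv]
    rw [Finset.insert_comm v u s]
    rcases lt_or_gt_of_ne huv with h | h
    · simp only [h, h.not_gt, if_true, if_false]; ring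
    · simp only [h, h.not_gt, if_true, if_false]; ring
  have h2 : ∑ u, ∑ v, F u v = - ∑ u, ∑ v, F u v := by
    conv_lhs => rw [Finset.sum_comm]
    simp only [← Finset.sum_neg_distrib]
    exact Finset.sum_congr rfl fun v _ => Finset.sum_congr rfl fun u _ => hanti u v
  rw [hsum, Pi.zero_apply]
  linarith

theorem chainBoundary_single (t : Finset V) :
    chainBoundary V (Pi.single t 1) =
      ∑ v ∈ t, (-1 : ℝ) ^ (t.filter (· < v)).card • Pi.single (t.erase v) (1 : ℝ) := by
  ext s
  rw [chainBoundary_apply, Finset.sum_apply, ← Finset.sum_filter_of_ne (s := Finset.univ)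
    (p := (· ∈ t)), Finset.filter_mem_eq_inter, Finset.univ_inter]
  · refine Finset.sum_congr rfl fun v hv => ?_
    simp only [Pi.smul_apply, Pi.single_apply, smul_eq_mul]
    by_cases hvs : v ∈ s
    · rw [if_pos hvs, if_neg, mul_zero]
      rintro rfl
      simp at hvs
    · rw [if_neg hvs]
      by_cases h : insert v s = t
      · subst h
        have h1 : (insert v s).filter (· < v) = s.filter (· < v) := by
          rw [Finset.filter_insert, if_neg (lt_irrefl v)]
        rw [h1, Finset.erase_insert hvs]
        simp
      · have h' : s ≠ t.erase v := by
          rintro rfl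
          exact h (Finset.insert_erase hv)
        rw [if_neg h, if_neg h', mul_zero, mul_zero]
  · intro v _ hne
    by_contra hv
    apply hne
    split_ifs
    · rfl
    · rw [Pi.single_apply, if_neg, mul_zero]
      rintro rfl
      simp at hv

end Boundary

/-! ### Chains of a complex as functions on all finite sets -/

namespace PreAbstractSimplicialComplex

theorem mem_of_insert_mem {V : Type*} [DecidableEq V] {K : PreAbstractSimplicialComplex V} {v : V} {s : Finset V}
    (h : insert v s ∈ K) (hs : s.Nonempty) : s ∈ K :=
  (K.isRelLowerSet_faces h).2 (Finset.subset_insert v s) hs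

variable {V : Type*}

open Classical in
/-- Extension by zero of a chain on the `k`-simplices of a complex. -/
noncomputable def extendChain (K : PreAbstractSimplicialComplex V) {k : ℕ}
    (y : K.Simplex k → ℝ) (s : Finset V) : ℝ :=
  if h : s ∈ K ∧ s.card = k + 1 then y ⟨s, h⟩ else 0

theorem extendChain_simplex (K : PreAbstractSimplicialComplex V) {k : ℕ} (y : K.Simplex k → ℝ)
    (σ : K.Simplex k) : K.extendChain y σ.1 = y σ :=
  dif_pos σ.2

theorem extendChain_of_not (K : PreAbstractSimplicialComplex V) {k : ℕ} (y : K.Simplex k → ℝ)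
    {s : Finset V} (h : ¬ (s ∈ K ∧ s.card = k + 1)) : K.extendChain y s = 0 :=
  dif_neg h

theorem extendChain_injective (K : PreAbstractSimplicialComplex V) {k : ℕ} :
    Function.Injective (K.extendChain (k := k)) := by
  intro y z h
  ext σ
  rw [← K.extendChain_simplex y, h, extendChain_simplex]

theorem extendChain_zero (K : PreAbstractSimplicialComplex V) {k : ℕ} :
    K.extendChain (0 : K.Simplex k → ℝ) = 0 := by
  ext s
  by_cases h : s ∈ K ∧ s.card = k + 1
  · exact K.extendChain_simplex _ ⟨s, h⟩
  · exact K.extendChain_of_not _ h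

theorem extendChain_restrict (K : PreAbstractSimplicialComplex V) {k : ℕ} (x : Finset V → ℝ)
    (hx : ∀ s, x s ≠ 0 → s ∈ K ∧ s.card = k + 1) :
    K.extendChain (fun σ : K.Simplex k => x σ.1) = x := by
  ext s
  by_cases h : s ∈ K ∧ s.card = k + 1
  · exact K.extendChain_simplex _ ⟨s, h⟩
  · rw [K.extendChain_of_not _ h]
    by_contra h0
    exact h (hx s fun h' => h0 h'.symm)

variable [Fintype V]

theorem sum_extendChain_sq (K : PreAbstractSimplicialComplex V) {k : ℕ} (y : K.Simplex k → ℝ) :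
    ∑ σ, y σ ^ 2 = ∑ s, K.extendChain y s ^ 2 := by
  refine Finset.sum_of_injOn (fun σ => σ.1) (fun _ _ _ _ h => Subtype.ext h) (by simp) ?_ ?_
  · intro s _ hs
    rw [K.extendChain_of_not, zero_pow two_ne_zero]
    intro h
    exact hs ⟨⟨s, h⟩, Finset.mem_coe.2 (Finset.mem_univ _), rfl⟩
  · intro σ _
    rw [extendChain_simplex]

variable [LinearOrder V]

theorem extendChain_boundary_mulVec (K : PreAbstractSimplicialComplex V) {k : ℕ}
    (y : K.Simplex (k + 1) → ℝ) :
    K.extendChain (K.boundary k *ᵥ y) = chainBoundary V (K.extendChain y) := by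
  ext s
  by_cases hs : s ∈ K ∧ s.card = k + 1
  · have h1 : K.extendChain (K.boundary k *ᵥ y) s = (K.boundary k *ᵥ y) ⟨s, hs⟩ :=
      K.extendChain_simplex _ ⟨s, hs⟩
    have h2 : (K.boundary k *ᵥ y) ⟨s, hs⟩ = ∑ v, ∑ σ : K.Simplex (k + 1),
        if v ∈ σ.1 ∧ s = σ.1.erase v then
          (-1 : ℝ) ^ (σ.1.filter (fun w => w < v)).card * y σ else 0 := by
      rw [Finset.sum_comm]
      refine Finset.sum_congr rfl fun σ _ => ?_
      change (∑ v ∈ σ.1, if s = σ.1.erase v then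
        (-1 : ℝ) ^ (σ.1.filter (fun w => w < v)).card else 0) * y σ = _
      rw [Finset.sum_mul, ← Finset.sum_filter_of_ne (s := Finset.univ) (p := (· ∈ σ.1)),
        Finset.filter_mem_eq_inter, Finset.univ_inter]
      · refine Finset.sum_congr rfl fun v hv => ?_
        simp [hv]
      · intro v _ hne
        by_contra hv
        simp [hv] at hne
    rw [h1, h2, chainBoundary_apply]
    refine Finset.sum_congr rfl fun v _ => ?_
    by_cases hvs : v ∈ s
    · rw [if_pos hvs]
      refine Finset.sum_eq_zero fun σ _ => if_neg ?_
      rintro ⟨-, rfl⟩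
      simp at hvs
    · rw [if_neg hvs]
      have key : ∀ σ : K.Simplex (k + 1), (v ∈ σ.1 ∧ s = σ.1.erase v) ↔ σ.1 = insert v s := by
        intro σ
        constructor
        · rintro ⟨h, h'⟩
          rw [h', Finset.insert_erase h]
        · intro h
          rw [h]
          exact ⟨Finset.mem_insert_self v s, (Finset.erase_insert hvs).symm⟩
      by_cases hins : insert v s ∈ K ∧ (insert v s).card = k + 1 + 1
      · obtain ⟨ρ, hρ⟩ : ∃ ρ : K.Simplex (k + 1), ρ.1 = insert v s := ⟨⟨insert v s, hins⟩, rfl⟩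
        refine (Finset.sum_eq_single ρ (fun σ _ hσ => if_neg fun h => hσ (Subtype.ext ?_))
          fun h => absurd (Finset.mem_univ ρ) h).trans ?_
        · exact ((key σ).1 h).trans hρ.symm
        · refine (if_pos ((key ρ).2 hρ)).trans ?_
          have h3 : (insert v s).filter (· < v) = s.filter (· < v) := by
            rw [Finset.filter_insert, if_neg (lt_irrefl v)]
          rw [← K.extendChain_simplex y, hρ, h3]
      · rw [K.extendChain_of_not _ hins, mul_zero]
        refine Finset.sum_eq_zero fun σ _ => if_neg fun h => hins ?_
        rw [← (key σ).1 h]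
        exact σ.2
  · rw [K.extendChain_of_not _ hs, chainBoundary_apply]
    symm
    refine Finset.sum_eq_zero fun v _ => ?_
    split_ifs with hvs
    · rfl
    · rw [K.extendChain_of_not, mul_zero]
      rintro ⟨h, hc⟩
      rw [Finset.card_insert_of_notMem hvs] at hc
      have hc' : s.card = k + 1 := by omega
      -- Downward closure applies only to non-empty sets; here `s` has `k + 1 ≥ 1` elements.
      exact hs ⟨mem_of_insert_mem h (Finset.card_pos.1 (by omega)), hc'⟩

theorem boundary_mulVec_boundary_mulVec (K : PreAbstractSimplicialComplex V) {k : ℕ}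
    (y : K.Simplex (k + 2) → ℝ) : K.boundary k *ᵥ (K.boundary (k + 1) *ᵥ y) = 0 := by
  apply K.extendChain_injective
  rw [extendChain_boundary_mulVec, extendChain_boundary_mulVec, chainBoundary_chainBoundary,
    extendChain_zero]

theorem downLaplacian_mulVec_boundary_mulVec (K : PreAbstractSimplicialComplex V) (k : ℕ)
    (y : K.Simplex (k + 1) → ℝ) : K.downLaplacian k *ᵥ (K.boundary k *ᵥ y) = 0 := by
  cases k with
  | zero => simp [downLaplacian]
  | succ k =>
    rw [downLaplacian, ← Matrix.mulVec_mulVec, boundary_mulVec_boundary_mulVec, Matrix.mulVec_zero]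

end PreAbstractSimplicialComplex

/-! ### Small eigenvalues -/

/-- If all eigenvalues of `AᵀA` exceeded `ε`, then `AᵀA - ε` would be positive definite,
contradicting the bound at `x`. Injectivity of `A` excludes the eigenvalue `0`. -/
theorem Matrix.exists_eigenvalue_transpose_mul_self_le {m n : Type*} [Fintype m] [Fintype n]
    (A : Matrix m n ℝ) (hA : ∀ y, A *ᵥ y = 0 → y = 0) {x : n → ℝ} (hx : x ≠ 0) {ε : ℝ}
    (h : (A *ᵥ x) ⬝ᵥ (A *ᵥ x) ≤ ε * (x ⬝ᵥ x)) :
    ∃ μ : ℝ, ∃ v : n → ℝ, v ≠ 0 ∧ μ ≠ 0 ∧ μ ≤ ε ∧ (A.transpose * A) *ᵥ v = μ • v := by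
  classical
  have hH : (A.transpose * A - ε • (1 : Matrix n n ℝ)).IsHermitian := by
    rw [Matrix.IsHermitian, Matrix.conjTranspose_eq_transpose_of_trivial]
    simp
  have hnot : ¬ (A.transpose * A - ε • (1 : Matrix n n ℝ)).PosDef := by
    intro hp
    have h1 := hp.dotProduct_mulVec_pos hx
    rw [Matrix.sub_mulVec, Matrix.smul_mulVec, Matrix.one_mulVec, ← Matrix.mulVec_mulVec,
      star_trivial, dotProduct_sub, Matrix.dotProduct_mulVec, Matrix.vecMul_transpose,
      dotProduct_smul, smul_eq_mul] at h1
    linarith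
  rw [hH.posDef_iff_eigenvalues_pos] at hnot
  push Not at hnot
  obtain ⟨i, hi⟩ := hnot
  set v : n → ℝ := ⇑(hH.eigenvectorBasis i) with hv
  have hv0 : v ≠ 0 := by
    intro h0
    have := hH.eigenvectorBasis.toBasis.ne_zero i
    apply this
    ext j
    simpa using congrFun h0 j
  have hev : (A.transpose * A) *ᵥ v = (hH.eigenvalues i + ε) • v := by
    have := hH.mulVec_eigenvectorBasis i
    rw [Matrix.sub_mulVec, Matrix.smul_mulVec, Matrix.one_mulVec, sub_eq_iff_eq_add] at this
    rw [add_smul]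
    exact this
  refine ⟨hH.eigenvalues i + ε, v, hv0, ?_, by linarith, hev⟩
  intro h0
  rw [h0, zero_smul] at hev
  apply hv0
  apply hA
  have h2 : v ⬝ᵥ ((A.transpose * A) *ᵥ v) = 0 := by rw [hev, dotProduct_zero]
  rw [← Matrix.mulVec_mulVec, Matrix.dotProduct_mulVec, Matrix.vecMul_transpose] at h2
  exact dotProduct_self_eq_zero.1 h2

theorem exists_isSpectralGap_le {ι : Type*} [Fintype ι] {A : Matrix ι ι ℝ} {μ : ℝ} {v : ι → ℝ}
    (hv : v ≠ 0) (hμ : μ ≠ 0) (h : A *ᵥ v = μ • v) : ∃ g ≤ μ, IsSpectralGap A g := by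
  have hmem : μ ∈ {ν : ℝ | ν ≠ 0 ∧ Module.End.HasEigenvalue A.mulVecLin ν} :=
    ⟨hμ, Module.End.hasEigenvalue_of_hasEigenvector
      (Module.End.hasEigenvector_iff.2 ⟨Module.End.mem_eigenspace_iff.2 h, hv⟩)⟩
  have hfin : {ν : ℝ | ν ≠ 0 ∧ Module.End.HasEigenvalue A.mulVecLin ν}.Finite :=
    (Module.End.finite_hasEigenvalue A.mulVecLin).subset fun _ h => h.2
  obtain ⟨g, hg, hmin⟩ := hfin.exists_minimalFor id _ ⟨μ, hmem⟩
  have hle : ∀ ν ∈ {ν : ℝ | ν ≠ 0 ∧ Module.End.HasEigenvalue A.mulVecLin ν}, g ≤ ν := by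
    intro ν hν
    rcases le_total g ν with h | h
    · exact h
    · exact hmin hν h
  exact ⟨g, hle μ hmem, hg, hle⟩

namespace PreAbstractSimplicialComplex

variable {V : Type*} [Fintype V] [LinearOrder V]

/-- One eigenvector `v` of `∂ᵀ∂` serves both Laplacians: `v` itself in the top dimension, where the
up part is an empty sum, and `∂v` one dimension below, where the down part vanishes. -/
theorem exists_spectralGaps_le (K : PreAbstractSimplicialComplex V) {k : ℕ}
    (hK : K.HasDimension (k + 1)) (hinj : ∀ y, K.boundary k *ᵥ y = 0 → y = 0)
    {x : K.Simplex (k + 1) → ℝ} (hx : x ≠ 0) {ε : ℝ}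
    (h : ∑ τ, (K.boundary k *ᵥ x) τ ^ 2 ≤ ε * ∑ σ, x σ ^ 2) :
    ∃ g₁ g₂ : ℝ, IsSpectralGap (K.laplacian k) g₁ ∧ IsSpectralGap (K.laplacian (k + 1)) g₂ ∧
      g₁ ≤ ε ∧ g₂ ≤ ε := by
  obtain ⟨μ, v, hv, hμ, hle, hev⟩ := (K.boundary k).exists_eigenvalue_transpose_mul_self_le hinj hx
    (ε := ε) (by simpa only [dotProduct, ← sq] using h)
  have hempty : IsEmpty (K.Simplex (k + 1 + 1)) := by
    by_contra hne
    rw [not_isEmpty_iff] at hne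
    have := hK.2 hne
    omega
  have hup : K.laplacian (k + 1) *ᵥ v = μ • v := by
    rw [← hev, laplacian, upLaplacian, downLaplacian, Matrix.add_mulVec, add_eq_right]
    ext τ
    simp [Matrix.mulVec, dotProduct, Matrix.mul_apply]
  have hdown : K.laplacian k *ᵥ (K.boundary k *ᵥ v) = μ • (K.boundary k *ᵥ v) := by
    rw [laplacian, upLaplacian, Matrix.add_mulVec, downLaplacian_mulVec_boundary_mulVec, add_zero,
      ← Matrix.mulVec_mulVec, Matrix.mulVec_mulVec v, hev, Matrix.mulVec_smul]
  obtain ⟨g₁, h₁, hg₁⟩ := exists_isSpectralGap_le (fun h0 => hv (hinj v h0)) hμ hdown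
  obtain ⟨g₂, h₂, hg₂⟩ := exists_isSpectralGap_le hv hμ hup
  exact ⟨g₁, g₂, hg₁, hg₂, h₁.trans hle, h₂.trans hle⟩

/-! ### Complexes generated by facets, and collapses -/

/-- The complex generated by a family of facets. -/
def ofFacets {V ι : Type*} (f : ι → Finset V) : PreAbstractSimplicialComplex V where
  faces := {s | s.Nonempty ∧ ∃ i, s ⊆ f i}
  isRelLowerSet_faces := by
    rintro s ⟨hs, i, hi⟩
    exact ⟨hs, fun t hts ht => ⟨ht, i, hts.trans hi⟩⟩

theorem mem_ofFacets_and_card {V ι : Type*} {f : ι → Finset V} {k : ℕ}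
    (hf : ∀ i, (f i).card = k + 1) {s : Finset V} :
    (s ∈ ofFacets f ∧ s.card = k + 1) ↔ s ∈ Set.range f := by
  constructor
  · rintro ⟨⟨-, i, hi⟩, hc⟩
    exact ⟨i, (Finset.eq_of_subset_of_card_le hi (by rw [hf, hc])).symm⟩
  · rintro ⟨i, rfl⟩
    exact ⟨⟨Finset.card_pos.1 (by rw [hf]; omega), i, subset_rfl⟩, hf i⟩

theorem numSimplices_ofFacets {V ι : Type*} {f : ι → Finset V} {k : ℕ}
    (hf : ∀ i, (f i).card = k + 1) : (ofFacets f).numSimplices k = (Set.range f).ncard := by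
  rw [numSimplices, ← Nat.card_coe_set_eq]
  exact Nat.card_congr (Equiv.subtypeEquivRight fun s => mem_ofFacets_and_card hf)

theorem hasDimension_ofFacets {V ι : Type*} [Nonempty ι] {f : ι → Finset V} {k : ℕ}
    (hf : ∀ i, (f i).card = k + 1) : (ofFacets f).HasDimension k := by
  constructor
  · exact ⟨⟨f (Classical.arbitrary ι), (mem_ofFacets_and_card hf).2 ⟨_, rfl⟩⟩⟩
  · rintro j ⟨⟨s, ⟨-, i, hi⟩, hc⟩⟩
    have := Finset.card_le_card hi
    rw [hf, hc] at this
    omega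

/-- If the facets can be removed one after the other, each through a face that lies in no other
remaining facet, then there is no cycle in the top dimension. -/
theorem eq_zero_of_chainBoundary_eq_zero_of_collapse {ι : Type*} {f : ι → Finset V} (rank : ι → ℕ)
    (hrank : ∀ i, ∃ v ∈ f i, ∀ j, (f i).erase v ⊆ f j → f j = f i ∨ rank j < rank i)
    {x : Finset V → ℝ} (hx : ∀ s, x s ≠ 0 → s ∈ Set.range f) (h : chainBoundary V x = 0) :
    x = 0 := by
  have key : ∀ r, ∀ i, rank i = r → x (f i) = 0 := by
    intro r
    induction r using Nat.strong_induction_on with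
    | _ r ih =>
      intro i hi
      obtain ⟨v, hv, hvi⟩ := hrank i
      -- At the free face only `x (f i)` survives: every other facet through it has smaller rank
      -- and, by induction, coefficient zero.
      have h1 := congrFun h ((f i).erase v)
      rw [chainBoundary_apply, Finset.sum_eq_single v] at h1
      · rw [if_neg (Finset.notMem_erase v _), Finset.insert_erase hv] at h1
        simpa using h1
      · intro w _ hw
        split_ifs with hwi
        · rfl
        · rw [mul_eq_zero]
          right
          by_contra hne
          obtain ⟨j, hj⟩ := hx _ hne
          rcases hvi j (by rw [hj]; exact Finset.subset_insert _ _) with h2 | h2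
          · have hwf : w ∈ f i := by rw [← h2, hj]; exact Finset.mem_insert_self _ _
            exact hwi (Finset.mem_erase.2 ⟨hw, hwf⟩)
          · exact hne (hj ▸ ih _ (hi ▸ h2) j rfl)
      · simp
  ext s
  by_contra hne
  obtain ⟨i, rfl⟩ := hx s hne
  exact hne (key _ i rfl)

theorem exists_spectralGaps_ofFacets_le {ι : Type*} [Nonempty ι] {f : ι → Finset V} {k : ℕ}
    (hf : ∀ i, (f i).card = k + 2) (rank : ι → ℕ)
    (hrank : ∀ i, ∃ v ∈ f i, ∀ j, (f i).erase v ⊆ f j → f j = f i ∨ rank j < rank i)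
    {x : Finset V → ℝ} (hx : ∀ s, x s ≠ 0 → s ∈ Set.range f) (hx0 : x ≠ 0) {ε : ℝ}
    (h : ∑ s, chainBoundary V x s ^ 2 ≤ ε * ∑ s, x s ^ 2) :
    ∃ g₁ g₂ : ℝ, IsSpectralGap ((ofFacets f).laplacian k) g₁ ∧
      IsSpectralGap ((ofFacets f).laplacian (k + 1)) g₂ ∧ g₁ ≤ ε ∧ g₂ ≤ ε := by
  have hext := (ofFacets f).extendChain_restrict (k := k + 1) x
    fun s hs => (mem_ofFacets_and_card hf).2 (hx s hs)
  refine exists_spectralGaps_le _ (hasDimension_ofFacets hf) ?_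
    (x := fun σ => x σ.1) ?_ ?_
  · intro y hy
    apply extendChain_injective
    rw [extendChain_zero]
    refine eq_zero_of_chainBoundary_eq_zero_of_collapse rank hrank ?_ ?_
    · intro s hs
      by_contra hne
      exact hs (extendChain_of_not _ _ fun h => hne ((mem_ofFacets_and_card hf).1 h))
    · rw [← extendChain_boundary_mulVec, hy, extendChain_zero]
  · intro h0
    rw [h0, extendChain_zero] at hext
    exact hx0 hext.symm
  · rw [sum_extendChain_sq, sum_extendChain_sq, extendChain_boundary_mulVec, hext]
    exact h

end PreAbstractSimplicialComplex

/-! ### Joins -/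

namespace Finset

variable {α β : Type*}

/-- The join of a set of vertices of `α` and one of `β`, the vertices of `α` coming first. -/
def lexJoin (s : Finset α) (t : Finset β) : Finset (α ⊕ₗ β) :=
  (s.disjSum t).map toLex.toEmbedding

/-- A finite set of vertices of `α ⊕ₗ β` is the join of its two parts. -/
def lexJoinEquiv : Finset α × Finset β ≃ Finset (α ⊕ₗ β) :=
  Finset.sumEquiv.symm.toEquiv.trans (Equiv.finsetCongr toLex)

theorem lexJoinEquiv_apply (s : Finset α) (t : Finset β) : lexJoinEquiv (s, t) = lexJoin s t := rfl

theorem inl_mem_lexJoin {s : Finset α} {t : Finset β} {a : α} :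
    toLex (Sum.inl a) ∈ lexJoin s t ↔ a ∈ s := by
  simp [lexJoin]

theorem inr_mem_lexJoin {s : Finset α} {t : Finset β} {b : β} :
    toLex (Sum.inr b) ∈ lexJoin s t ↔ b ∈ t := by
  simp [lexJoin]

theorem card_lexJoin (s : Finset α) (t : Finset β) : (lexJoin s t).card = s.card + t.card := by
  simp [lexJoin]

theorem lexJoin_subset_lexJoin {s s' : Finset α} {t t' : Finset β} :
    lexJoin s t ⊆ lexJoin s' t' ↔ s ⊆ s' ∧ t ⊆ t' := by
  constructor
  · intro h
    exact ⟨fun a ha => inl_mem_lexJoin.1 (h (inl_mem_lexJoin.2 ha)),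
      fun b hb => inr_mem_lexJoin.1 (h (inr_mem_lexJoin.2 hb))⟩
  · rintro ⟨h, h'⟩ v hv
    rcases v with a | b
    · exact inl_mem_lexJoin.2 (h (inl_mem_lexJoin.1 hv))
    · exact inr_mem_lexJoin.2 (h' (inr_mem_lexJoin.1 hv))

variable [DecidableEq (α ⊕ₗ β)]

theorem insert_inl_lexJoin [DecidableEq α] (s : Finset α) (t : Finset β) (a : α) :
    insert (toLex (Sum.inl a)) (lexJoin s t) = lexJoin (insert a s) t := by
  ext v
  obtain ⟨a | b, rfl⟩ := toLex.surjective v <;>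
    simp [inl_mem_lexJoin, inr_mem_lexJoin]

theorem insert_inr_lexJoin [DecidableEq β] (s : Finset α) (t : Finset β) (b : β) :
    insert (toLex (Sum.inr b)) (lexJoin s t) = lexJoin s (insert b t) := by
  ext v
  obtain ⟨a | b, rfl⟩ := toLex.surjective v <;>
    simp [inl_mem_lexJoin, inr_mem_lexJoin]

theorem erase_inl_lexJoin [DecidableEq α] (s : Finset α) (t : Finset β) (a : α) :
    (lexJoin s t).erase (toLex (Sum.inl a)) = lexJoin (s.erase a) t := by
  ext v
  obtain ⟨a | b, rfl⟩ := toLex.surjective v <;>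
    simp [inl_mem_lexJoin, inr_mem_lexJoin]

end Finset

section Join

open Finset

variable {α β : Type*}

/-- The join of two chains. -/
def joinChain (x : Finset α → ℝ) (y : Finset β → ℝ) (u : Finset (α ⊕ₗ β)) : ℝ :=
  x (lexJoinEquiv.symm u).1 * y (lexJoinEquiv.symm u).2

theorem joinChain_lexJoin (x : Finset α → ℝ) (y : Finset β → ℝ) (s : Finset α) (t : Finset β) :
    joinChain x y (lexJoin s t) = x s * y t := by
  rw [joinChain, ← lexJoinEquiv_apply, Equiv.symm_apply_apply]

theorem sum_joinChain_sq [Fintype α] [Fintype β] (x : Finset α → ℝ) (y : Finset β → ℝ) :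
    ∑ u, joinChain x y u ^ 2 = (∑ s, x s ^ 2) * ∑ t, y t ^ 2 := by
  rw [← lexJoinEquiv.sum_comp, Fintype.sum_prod_type, Finset.sum_mul_sum]
  refine Finset.sum_congr rfl fun s _ => Finset.sum_congr rfl fun t _ => ?_
  rw [lexJoinEquiv_apply, joinChain_lexJoin, mul_pow]

variable [LinearOrder α] [LinearOrder β]

theorem card_filter_lt_inl_lexJoin (s : Finset α) (t : Finset β) (a : α) :
    ((lexJoin s t).filter (· < toLex (Sum.inl a))).card = (s.filter (· < a)).card := by
  have : (lexJoin s t).filter (· < toLex (Sum.inl a)) = lexJoin (s.filter (· < a)) ∅ := by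
    ext v
    obtain ⟨a | b, rfl⟩ := toLex.surjective v <;>
      simp [inl_mem_lexJoin, inr_mem_lexJoin, Sum.Lex.toLex_lt_toLex]
  rw [this, card_lexJoin, card_empty, add_zero]

theorem card_filter_lt_inr_lexJoin (s : Finset α) (t : Finset β) (b : β) :
    ((lexJoin s t).filter (· < toLex (Sum.inr b))).card =
      s.card + (t.filter (· < b)).card := by
  have : (lexJoin s t).filter (· < toLex (Sum.inr b)) = lexJoin s (t.filter (· < b)) := by
    ext v
    obtain ⟨a | b, rfl⟩ := toLex.surjective v <;>
      simp [inl_mem_lexJoin, inr_mem_lexJoin, Sum.Lex.toLex_lt_toLex]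
  rw [this, card_lexJoin]

variable [Fintype α] [Fintype β]

/-- Leibniz rule; the sign arises because all of `s` precedes each vertex of `β`. It holds without
exceptional cases because the empty set counts as a simplex. -/
theorem chainBoundary_joinChain_lexJoin (x : Finset α → ℝ) (y : Finset β → ℝ) (s : Finset α)
    (t : Finset β) :
    chainBoundary (α ⊕ₗ β) (joinChain x y) (lexJoin s t) =
      chainBoundary α x s * y t + (-1 : ℝ) ^ s.card * x s * chainBoundary β y t := by
  rw [chainBoundary_apply, ← (toLex (α := α ⊕ β)).sum_comp, Fintype.sum_sum_type]
  congr 1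
  · rw [chainBoundary_apply, Finset.sum_mul]
    refine Finset.sum_congr rfl fun a _ => ?_
    rw [card_filter_lt_inl_lexJoin, insert_inl_lexJoin, joinChain_lexJoin]
    simp only [inl_mem_lexJoin]
    split_ifs <;> ring
  · rw [chainBoundary_apply, Finset.mul_sum]
    refine Finset.sum_congr rfl fun b _ => ?_
    rw [card_filter_lt_inr_lexJoin, insert_inr_lexJoin, joinChain_lexJoin, pow_add]
    simp only [inr_mem_lexJoin]
    split_ifs <;> ring

theorem chainBoundary_joinChain (x : Finset α → ℝ) {y : Finset β → ℝ}
    (hy : chainBoundary β y = 0) :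
    chainBoundary (α ⊕ₗ β) (joinChain x y) = joinChain (chainBoundary α x) y := by
  ext u
  obtain ⟨⟨s, t⟩, rfl⟩ := lexJoinEquiv.surjective u
  rw [lexJoinEquiv_apply, chainBoundary_joinChain_lexJoin, joinChain_lexJoin, hy]
  simp

namespace PreAbstractSimplicialComplex

/-- The join of a collapsible family of facets with a sphere inherits its bounds on the spectral
gaps. -/
theorem exists_spectralGaps_ofFacets_lexJoin_le {ι κ : Type*} [Nonempty ι] [Nonempty κ]
    {f : ι → Finset α} {k : ℕ} (hf : ∀ i, (f i).card = k + 2) (rank : ι → ℕ)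
    (hrank : ∀ i, ∃ v ∈ f i, ∀ j, (f i).erase v ⊆ f j → f j = f i ∨ rank j < rank i)
    {x : Finset α → ℝ} (hx : ∀ s, x s ≠ 0 → s ∈ Set.range f) (hx0 : x ≠ 0) {ε : ℝ}
    (h : ∑ s, chainBoundary α x s ^ 2 ≤ ε * ∑ s, x s ^ 2)
    {g : κ → Finset β} {l : ℕ} (hg : ∀ j, (g j).card = l)
    {y : Finset β → ℝ} (hy : ∀ t, y t ≠ 0 → t ∈ Set.range g) (hy0 : y ≠ 0)
    (hcycle : chainBoundary β y = 0) :
    ∃ g₁ g₂ : ℝ,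
      IsSpectralGap ((ofFacets fun p : ι × κ => lexJoin (f p.1) (g p.2)).laplacian (k + l)) g₁ ∧
      IsSpectralGap ((ofFacets fun p : ι × κ => lexJoin (f p.1) (g p.2)).laplacian (k + l + 1)) g₂ ∧
      g₁ ≤ ε ∧ g₂ ≤ ε := by
  refine exists_spectralGaps_ofFacets_le (fun p => ?_) (fun p => rank p.1) (fun p => ?_)
    (x := joinChain x y) ?_ ?_ ?_
  · rw [card_lexJoin, hf, hg]
    ring
  · obtain ⟨v, hv, hvi⟩ := hrank p.1
    refine ⟨toLex (Sum.inl v), inl_mem_lexJoin.2 hv, fun q hq => ?_⟩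
    rw [erase_inl_lexJoin, lexJoin_subset_lexJoin] at hq
    -- The sets `g j` all have the same size, so inclusion forces equality and the free face stays
    -- free in the join.
    have hgq : g q.2 = g p.2 :=
      (Finset.eq_of_subset_of_card_le hq.2 (by rw [hg, hg])).symm
    rcases hvi q.1 hq.1 with h' | h'
    · left
      simp only [h', hgq]
    · exact Or.inr h'
  · intro u hu
    obtain ⟨⟨s, t⟩, rfl⟩ := lexJoinEquiv.surjective u
    rw [lexJoinEquiv_apply, joinChain_lexJoin] at hu
    obtain ⟨i, rfl⟩ := hx s (left_ne_zero_of_mul hu)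
    obtain ⟨j, rfl⟩ := hy t (right_ne_zero_of_mul hu)
    exact ⟨(i, j), rfl⟩
  · obtain ⟨s, hs⟩ := Function.ne_iff.1 hx0
    obtain ⟨t, ht⟩ := Function.ne_iff.1 hy0
    refine Function.ne_iff.2 ⟨lexJoin s t, ?_⟩
    rw [joinChain_lexJoin]
    exact mul_ne_zero hs ht
  · rw [chainBoundary_joinChain x hcycle, sum_joinChain_sq, sum_joinChain_sq, ← mul_assoc]
    exact mul_le_mul_of_nonneg_right h (Finset.sum_nonneg fun t _ => sq_nonneg (y t))

end PreAbstractSimplicialComplex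

end Join

/-! ### Iterated mapping cylinders of the map of degree two of a circle -/

namespace DoublingTelescope

/-- The triangles of a mapping cylinder of the map of degree two from the hexagon with vertices
`0, 1, 2, 0, 1, 2` to the triangle with vertices `3, 4, 5`, in an order in which they can be
collapsed from the side of `3, 4, 5`. -/
def localTriangle : Fin 9 → Fin 6 × Fin 6 × Fin 6 :=
  ![(2, 3, 4), (1, 2, 3), (0, 1, 3), (0, 3, 5), (0, 2, 5), (1, 2, 5), (1, 4, 5), (0, 1, 4),
    (0, 2, 4)]

/-- The orientations for which the triangles form a cylinder. -/
def localSign : Fin 9 → ℝ := ![-1, 1, 1, 1, -1, 1, -1, 1, -1]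

/-- The vertex of each triangle whose opposite edge is free once the earlier triangles are gone. -/
def localApex : Fin 9 → Fin 6 := ![2, 1, 0, 5, 2, 1, 4, 0, 2]

/-- The vertex set of a local triangle. -/
def localFacet (j : Fin 9) : Finset (Fin 6) :=
  {(localTriangle j).1, (localTriangle j).2.1, (localTriangle j).2.2}

theorem localApex_mem (j : Fin 9) : localApex j ∈ localFacet j := by
  revert j; decide

theorem localFacet_card (j : Fin 9) : (localFacet j).card = 3 := by
  revert j; decide

theorem exists_upper_mem_erase_apex (j : Fin 9) :
    ∃ v ∈ (localFacet j).erase (localApex j), 3 ≤ v.1 := by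
  revert j; decide

theorem eq_or_lt_of_erase_apex_subset (j j' : Fin 9)
    (h : (localFacet j).erase (localApex j) ⊆ localFacet j') : j' = j ∨ j' < j := by
  revert j j'; decide

variable (m : ℕ)

/-- The vertices `0, …, 5` of the cylinder at level `i`. -/
def levelEmbedding (i : Fin m) : Fin 6 ↪ Fin (3 * (m + 1)) where
  toFun j := ⟨3 * i.1 + j.1, by omega⟩
  inj' j j' h := by
    simp only [Fin.mk.injEq] at h
    omega

theorem levelEmbedding_val (i : Fin m) (j : Fin 6) :
    (levelEmbedding m i j).1 = 3 * i.1 + j.1 := rfl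

/-- The triangle on which the telescope starts. -/
def capFacet : Finset (Fin (3 * (m + 1))) :=
  {⟨0, by omega⟩, ⟨1, by omega⟩, ⟨2, by omega⟩}

/-- The facets of the telescope. -/
def facet : Option (Fin m × Fin 9) → Finset (Fin (3 * (m + 1)))
  | none => capFacet m
  | some (i, j) => (localFacet j).map (levelEmbedding m i)

/-- The order in which the facets are collapsed. -/
def facetRank : Option (Fin m × Fin 9) → ℕ
  | none => 9 * (m + 1)
  | some (i, j) => 9 * (m - i.1) + j.1

theorem mem_capFacet {v : Fin (3 * (m + 1))} : v ∈ capFacet m ↔ v.1 < 3 := by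
  simp only [capFacet, Finset.mem_insert, Finset.mem_singleton, Fin.ext_iff]
  omega

theorem card_capFacet : (capFacet m).card = 3 := by
  simp [capFacet]

theorem facet_card (p : Option (Fin m × Fin 9)) : (facet m p).card = 3 := by
  rcases p with _ | ⟨i, j⟩
  · exact card_capFacet m
  · rw [facet, Finset.card_map, localFacet_card]

/-- The highest level is collapsed first. Each free edge has a vertex among `3, 4, 5`, so only
triangles of its own level and of the next one can contain it, and the next level has smaller rank.
-/
theorem facet_collapse (p : Option (Fin m × Fin 9)) :
    ∃ v ∈ facet m p, ∀ q, (facet m p).erase v ⊆ facet m q →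
      facet m q = facet m p ∨ facetRank m q < facetRank m p := by
  rcases p with _ | ⟨i, j⟩
  -- The cap is removed last, so any of its vertices would do.
  · refine ⟨⟨0, by omega⟩, by simp [facet, mem_capFacet], fun q _ => ?_⟩
    rcases q with _ | ⟨i, j⟩
    · exact Or.inl rfl
    · right
      simp only [facetRank]
      omega
  · refine ⟨levelEmbedding m i (localApex j), ?_, fun q hq => ?_⟩
    · exact Finset.mem_map_of_mem _ (localApex_mem j)
    · rw [facet, ← Finset.map_erase] at hq
      obtain ⟨v, hv, hv3⟩ := exists_upper_mem_erase_apex j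
      have hmem := hq (Finset.mem_map_of_mem _ hv)
      rcases q with _ | ⟨i', j'⟩
      · have := (mem_capFacet m).1 hmem
        rw [levelEmbedding_val] at this
        omega
      · obtain ⟨w, hw, hwv⟩ := Finset.mem_map.1 hmem
        rw [Fin.ext_iff, levelEmbedding_val, levelEmbedding_val] at hwv
        have hii : i'.1 = i.1 ∨ i'.1 = i.1 + 1 := by omega
        rcases hii with h | h
        · obtain rfl : i' = i := Fin.ext h
          rw [facet, Finset.map_subset_map] at hq
          rcases eq_or_lt_of_erase_apex_subset j j' hq with rfl | hlt
          · exact Or.inl rfl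
          · right
            simp only [facetRank]
            have : j'.1 < j.1 := hlt
            omega
        · right
          simp only [facetRank]
          omega

theorem ncard_range_facet_le : (Set.range (facet m)).ncard ≤ 9 * m + 1 := by
  rw [← Set.image_univ]
  refine (Set.ncard_image_le).trans ?_
  simp [Set.ncard_univ, mul_comm]

theorem le_ncard_range_facet : m ≤ (Set.range (facet m)).ncard := by
  -- One triangle per level is enough; triangle `2` is `(0, 1, 3)`, whose lowest vertex `3 * i`
  -- determines the level.
  let g : Fin m → Finset (Fin (3 * (m + 1))) := fun i => facet m (some (i, 2))
  have hg : Function.Injective g := by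
    intro i i' h
    have key : ∀ i i' : Fin m, g i = g i' → i'.1 ≤ i.1 := by
      intro i i' h
      have h0 : levelEmbedding m i 0 ∈ g i :=
        Finset.mem_map_of_mem _ (by decide)
      rw [h] at h0
      obtain ⟨w, -, hw⟩ := Finset.mem_map.1 h0
      rw [Fin.ext_iff, levelEmbedding_val, levelEmbedding_val] at hw
      simp only [Fin.val_zero] at hw
      omega
    exact Fin.ext (le_antisymm (key i' i h.symm) (key i i' h))
  calc m = (Set.range g).ncard := by
        rw [← Nat.card_coe_set_eq, Nat.card_range_of_injective hg, Nat.card_fin]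
    _ ≤ _ := Set.ncard_le_ncard (by rintro _ ⟨i, rfl⟩; exact ⟨_, rfl⟩) (Set.toFinite _)

end DoublingTelescope

/-! ### A chain with small boundary on the telescope -/

section Triangle

variable {V : Type*} [Fintype V] [LinearOrder V]

/-- The boundary cycle of the triangle with vertices `a < b < c`. -/
def triangleCycle {V : Type*} [DecidableEq V] (a b c : V) : Finset V → ℝ :=
  Pi.single {b, c} 1 - Pi.single {a, c} 1 + Pi.single {a, b} 1

theorem chainBoundary_single_pair {a b : V} (hab : a < b) :
    chainBoundary V (Pi.single {a, b} 1) = Pi.single {b} 1 - Pi.single {a} 1 := by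
  have h1 : ({a, b} : Finset V).erase a = {b} := by
    rw [Finset.erase_insert (by simp [hab.ne])]
  have h2 : ({a, b} : Finset V).erase b = {a} := by
    rw [Finset.pair_comm, Finset.erase_insert (by simp [hab.ne'])]
  rw [chainBoundary_single, Finset.sum_pair hab.ne, h1, h2]
  simp [Finset.filter_insert, Finset.filter_singleton, hab, hab.not_gt, sub_eq_add_neg]

theorem chainBoundary_single_triple {a b c : V} (hab : a < b) (hbc : b < c) :
    chainBoundary V (Pi.single {a, b, c} 1) = triangleCycle a b c := by
  have hac := hab.trans hbc
  have h1 : ({a, b, c} : Finset V).erase a = {b, c} := by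
    rw [Finset.erase_insert (by simp [hab.ne, hac.ne])]
  have h2 : ({a, b, c} : Finset V).erase b = {a, c} := by
    rw [Finset.insert_comm, Finset.erase_insert (by simp [hab.ne', hbc.ne])]
  have h3 : ({a, b, c} : Finset V).erase c = {a, b} := by
    rw [Finset.pair_comm, Finset.insert_comm,
      Finset.erase_insert (by simp [hac.ne', hbc.ne'])]
  rw [chainBoundary_single, Finset.sum_insert (by simp [hab.ne, hac.ne]), Finset.sum_pair hbc.ne,
    h1, h2, h3, triangleCycle]
  simp [Finset.filter_insert, Finset.filter_singleton, hab, hab.not_gt, hbc, hbc.not_gt, hac,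
    hac.not_gt, Finset.card_pair hab.ne, sub_eq_add_neg, add_assoc]

theorem sum_single_sq {ι : Type*} [Fintype ι] [DecidableEq ι] (i : ι) :
    ∑ j, (Pi.single i 1 : ι → ℝ) j ^ 2 = 1 := by
  rw [Finset.sum_eq_single i]
  · simp
  · intro j _ hj
    simp [hj]
  · simp

/-- The inequality `(p - q + r)² ≤ 3 (p² + q² + r²)` gives a crude bound that does not need the
three edges to be distinct. -/
theorem sum_triangleCycle_sq_le {V : Type*} [Fintype V] [DecidableEq V] (a b c : V) :
    ∑ s, triangleCycle a b c s ^ 2 ≤ 9 := by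
  calc ∑ s, triangleCycle a b c s ^ 2
      ≤ ∑ s : Finset V, 3 * ((Pi.single {b, c} 1 : Finset V → ℝ) s ^ 2 +
        (Pi.single {a, c} 1 : Finset V → ℝ) s ^ 2 + (Pi.single {a, b} 1 : Finset V → ℝ) s ^ 2) := by
        refine Finset.sum_le_sum fun s _ => ?_
        simp only [triangleCycle, Pi.add_apply, Pi.sub_apply]
        generalize (Pi.single {b, c} 1 : Finset V → ℝ) s = p
        generalize (Pi.single {a, c} 1 : Finset V → ℝ) s = q
        generalize (Pi.single {a, b} 1 : Finset V → ℝ) s = r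
        nlinarith [sq_nonneg (p + q), sq_nonneg (q + r), sq_nonneg (p - r)]
    _ = 9 := by
        rw [← Finset.mul_sum, Finset.sum_add_distrib, Finset.sum_add_distrib, sum_single_sq,
          sum_single_sq, sum_single_sq]
        norm_num

end Triangle

namespace DoublingTelescope

variable (m : ℕ)

/-- The `k`-th vertex of the telescope. -/
def vertex (k : ℕ) : Fin (3 * (m + 1)) := Fin.ofNat _ k

/-- The circle at level `i`. -/
def levelCycle (i : ℕ) : Finset (Fin (3 * (m + 1))) → ℝ :=
  triangleCycle (vertex m (3 * i)) (vertex m (3 * i + 1)) (vertex m (3 * i + 2))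

/-- The cylinder between the levels `i` and `i + 1`. -/
noncomputable def levelCylinder (i : Fin m) : Finset (Fin (3 * (m + 1))) → ℝ :=
  ∑ j, localSign j • Pi.single (facet m (some (i, j))) 1

theorem levelEmbedding_apply (i : Fin m) (j : Fin 6) :
    levelEmbedding m i j = vertex m (3 * i.1 + j.1) := by
  rw [Fin.ext_iff, levelEmbedding_val, vertex, Fin.val_ofNat, Nat.mod_eq_of_lt (by omega)]

theorem levelEmbedding_strictMono (i : Fin m) : StrictMono (levelEmbedding m i) := by
  intro j j' h
  rw [Fin.lt_def, levelEmbedding_val, levelEmbedding_val]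
  have : j.1 < j'.1 := h
  omega

theorem chainBoundary_single_facet (i : Fin m) (j : Fin 9) :
    chainBoundary _ (Pi.single (facet m (some (i, j))) 1) =
      triangleCycle (levelEmbedding m i (localTriangle j).1)
        (levelEmbedding m i (localTriangle j).2.1) (levelEmbedding m i (localTriangle j).2.2) := by
  have h : ∀ j, (localTriangle j).1 < (localTriangle j).2.1 ∧
      (localTriangle j).2.1 < (localTriangle j).2.2 := by decide
  rw [← chainBoundary_single_triple (levelEmbedding_strictMono m i (h j).1)
    (levelEmbedding_strictMono m i (h j).2)]
  simp only [facet, localFacet, Finset.map_insert, Finset.map_singleton]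

/-- With these signs the edges joining the two levels cancel, each lower edge occurs twice with the
same orientation, and each upper edge once. -/
theorem chainBoundary_levelCylinder (i : Fin m) :
    chainBoundary _ (levelCylinder m i) =
      (2 : ℝ) • levelCycle m i.1 - levelCycle m (i.1 + 1) := by
  have hsucc : levelCycle m (i.1 + 1) = triangleCycle (vertex m (3 * i.1 + 3))
      (vertex m (3 * i.1 + 4)) (vertex m (3 * i.1 + 5)) := rfl
  rw [levelCylinder, map_sum, hsucc, levelCycle]
  simp only [map_smul, chainBoundary_single_facet, levelEmbedding_apply]
  rw [Fin.sum_univ_castSucc, Fin.sum_univ_eight]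
  simp [localSign, localTriangle, triangleCycle]
  module

end DoublingTelescope

namespace DoublingTelescope

variable (m : ℕ)

/-- A chain on the telescope that halves from each level to the next. -/
noncomputable def telescopeChain : Finset (Fin (3 * (m + 1))) → ℝ :=
  (2 : ℝ) • Pi.single (capFacet m) 1 - ∑ i : Fin m, (1 / 2 : ℝ) ^ i.1 • levelCylinder m i

theorem chainBoundary_telescopeChain :
    chainBoundary _ (telescopeChain m) = (2 * (1 / 2 : ℝ) ^ m) • levelCycle m m := by
  -- The identity is formal in `N`; that the vertices wrap around modulo `3 * (m + 1)` for `N > m`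
  -- is harmless.
  have htel : ∀ N, ∑ i ∈ Finset.range N,
      (1 / 2 : ℝ) ^ i • ((2 : ℝ) • levelCycle m i - levelCycle m (i + 1)) =
        (2 : ℝ) • levelCycle m 0 - (2 * (1 / 2 : ℝ) ^ N) • levelCycle m N := by
    intro N
    induction N with
    | zero => simp
    | succ N ih =>
      rw [Finset.sum_range_succ, ih, pow_succ]
      module
  have hcap : chainBoundary _ (Pi.single (capFacet m) 1) = levelCycle m 0 := by
    have h : ∀ k, k < 3 → (vertex m k).1 = k := fun k hk => by
      rw [vertex, Fin.val_ofNat, Nat.mod_eq_of_lt (by omega)]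
    have h01 : vertex m 0 < vertex m 1 := by
      rw [Fin.lt_def, h 0 (by omega), h 1 (by omega)]; omega
    have h12 : vertex m 1 < vertex m 2 := by
      rw [Fin.lt_def, h 1 (by omega), h 2 (by omega)]; omega
    have hcap : capFacet m = {vertex m 0, vertex m 1, vertex m 2} := by
      ext v
      simp only [mem_capFacet, Finset.mem_insert, Finset.mem_singleton, Fin.ext_iff,
        h 0 (by omega), h 1 (by omega), h 2 (by omega)]
      omega
    rw [hcap, chainBoundary_single_triple h01 h12]
    rfl
  rw [telescopeChain, map_sub, map_smul, map_sum, hcap]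
  simp only [map_smul, chainBoundary_levelCylinder]
  rw [Fin.sum_univ_eq_sum_range (fun i => (1 / 2 : ℝ) ^ i •
    ((2 : ℝ) • levelCycle m i - levelCycle m (i + 1))) m, htel, sub_sub_cancel]

theorem facet_some_ne_capFacet (i : Fin m) (j : Fin 9) : facet m (some (i, j)) ≠ capFacet m := by
  intro h
  obtain ⟨v, hv, hv3⟩ := exists_upper_mem_erase_apex j
  have hmem : levelEmbedding m i v ∈ facet m (some (i, j)) :=
    Finset.mem_map_of_mem _ (Finset.mem_of_mem_erase hv)
  rw [h, mem_capFacet, levelEmbedding_val] at hmem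
  omega

theorem telescopeChain_capFacet : telescopeChain m (capFacet m) = 2 := by
  simp [telescopeChain, levelCylinder, Finset.sum_apply,
    (facet_some_ne_capFacet m _ _).symm]

theorem mem_range_facet_of_telescopeChain_ne_zero (s : Finset (Fin (3 * (m + 1))))
    (hs : telescopeChain m s ≠ 0) : s ∈ Set.range (facet m) := by
  by_contra hne
  have h : ∀ p, s ≠ facet m p := fun p hp => hne ⟨p, hp.symm⟩
  apply hs
  simp [telescopeChain, levelCylinder, Finset.sum_apply, h (some _),
    show s ≠ capFacet m from h none]

theorem sum_chainBoundary_telescopeChain_sq_le :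
    ∑ s, chainBoundary _ (telescopeChain m) s ^ 2 ≤
      9 / 4 ^ m * ∑ s, telescopeChain m s ^ 2 := by
  -- The coefficient `2` of the cap alone gives this bound.
  have h1 : (4 : ℝ) ≤ ∑ s, telescopeChain m s ^ 2 := by
    calc (4 : ℝ) = telescopeChain m (capFacet m) ^ 2 := by
          rw [telescopeChain_capFacet]; norm_num
      _ ≤ _ := Finset.single_le_sum (f := fun s => telescopeChain m s ^ 2)
          (fun s _ => sq_nonneg _) (Finset.mem_univ _)
  have h2 : ∑ s, levelCycle m m s ^ 2 ≤ 9 := sum_triangleCycle_sq_le _ _ _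
  have h3 : (2 * (1 / 2 : ℝ) ^ m) ^ 2 = 4 / 4 ^ m := by
    rw [mul_pow, ← pow_mul, mul_comm m 2, pow_mul, one_div, inv_pow, inv_pow]
    norm_num
    rfl
  calc ∑ s, chainBoundary _ (telescopeChain m) s ^ 2
      = 4 / 4 ^ m * ∑ s, levelCycle m m s ^ 2 := by
        rw [chainBoundary_telescopeChain, Finset.mul_sum]
        refine Finset.sum_congr rfl fun s _ => ?_
        rw [Pi.smul_apply, smul_eq_mul, mul_pow, h3]
    _ ≤ 4 / 4 ^ m * 9 := by gcongr
    _ = 9 / 4 ^ m * 4 := by ring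
    _ ≤ _ := by gcongr

end DoublingTelescope

/-! ### The boundary of a simplex -/

theorem chainBoundary_single_univ_erase_ne_zero {V : Type*} [Fintype V] [LinearOrder V] (v : V) :
    chainBoundary V (Pi.single Finset.univ 1) (Finset.univ.erase v) ≠ 0 := by
  rw [chainBoundary_apply, Finset.sum_eq_single v]
  · simp
  · intro w _ hw
    simp [hw]
  · simp

theorem mem_range_erase_of_chainBoundary_single_univ_ne_zero {V : Type*} [Fintype V]
    [LinearOrder V] (s : Finset V) (hs : chainBoundary V (Pi.single Finset.univ 1) s ≠ 0) :
    s ∈ Set.range (Finset.univ : Finset V).erase := by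
  by_contra hne
  apply hs
  rw [chainBoundary_single, Finset.sum_apply]
  refine Finset.sum_eq_zero fun v _ => ?_
  have h : s ≠ Finset.univ.erase v := fun h => hne ⟨v, h.symm⟩
  simp [h]

namespace PreAbstractSimplicialComplex

open Finset in
theorem ncard_range_lexJoin {α β ι κ : Type*} (f : ι → Finset α) (g : κ → Finset β) :
    (Set.range fun p : ι × κ => lexJoin (f p.1) (g p.2)).ncard =
      (Set.range f).ncard * (Set.range g).ncard := by
  have h : (Set.range fun p : ι × κ => lexJoin (f p.1) (g p.2)) =
      lexJoinEquiv '' (Set.range f ×ˢ Set.range g) := by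
    rw [← Set.range_prodMap, ← Set.range_comp]
    rfl
  rw [h, Set.ncard_image_of_injective _ lexJoinEquiv.injective, Set.ncard_prod]

/-- The join of the telescope of height `m` and the boundary of an `l + 1`-simplex. -/
theorem exists_telescope_join (l m : ℕ) :
    ∃ (V : Type) (_ : Finite V) (_ : LinearOrder V) (K : PreAbstractSimplicialComplex V),
      K.HasDimension (1 + l + 1) ∧ m * (l + 1) ≤ K.numSimplices (1 + l + 1) ∧
      K.numSimplices (1 + l + 1) ≤ (9 * m + 1) * (l + 1) ∧
      ∃ g₁ g₂ : ℝ, IsSpectralGap (K.laplacian (1 + l)) g₁ ∧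
        IsSpectralGap (K.laplacian (1 + l + 1)) g₂ ∧ g₁ ≤ 9 / 4 ^ m ∧ g₂ ≤ 9 / 4 ^ m := by
  -- For `l = 0` the only set in this family is empty, and the join is the telescope itself.
  let g : Fin (l + 1) → Finset (Fin (l + 1)) := Finset.univ.erase
  have hg : ∀ j, (g j).card = l := fun j => by
    simp [g, Finset.card_erase_of_mem]
  have hginj : Function.Injective g := fun i j h =>
    Finset.erase_injOn _ (Finset.mem_coe.2 (Finset.mem_univ i))
      (Finset.mem_coe.2 (Finset.mem_univ j)) h
  have hgcard : (Set.range g).ncard = l + 1 := by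
    rw [← Nat.card_coe_set_eq, Nat.card_range_of_injective hginj, Nat.card_fin]
  have hcard : ∀ p : Option (Fin m × Fin 9) × Fin (l + 1),
      (Finset.lexJoin (DoublingTelescope.facet m p.1) (g p.2)).card = (1 + l + 1) + 1 := fun p => by
    rw [Finset.card_lexJoin, DoublingTelescope.facet_card, hg]
    ring
  refine ⟨Fin (3 * (m + 1)) ⊕ₗ Fin (l + 1), inferInstance, inferInstance,
    ofFacets fun p : Option (Fin m × Fin 9) × Fin (l + 1) =>
      Finset.lexJoin (DoublingTelescope.facet m p.1) (g p.2),
    hasDimension_ofFacets hcard, ?_, ?_, ?_⟩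
  · rw [numSimplices_ofFacets hcard, ncard_range_lexJoin, hgcard]
    exact Nat.mul_le_mul_right _ (DoublingTelescope.le_ncard_range_facet m)
  · rw [numSimplices_ofFacets hcard, ncard_range_lexJoin, hgcard]
    exact Nat.mul_le_mul_right _ (DoublingTelescope.ncard_range_facet_le m)
  · refine exists_spectralGaps_ofFacets_lexJoin_le (DoublingTelescope.facet_card m)
      (DoublingTelescope.facetRank m) (DoublingTelescope.facet_collapse m)
      (DoublingTelescope.mem_range_facet_of_telescopeChain_ne_zero m) ?_
      (DoublingTelescope.sum_chainBoundary_telescopeChain_sq_le m) hg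
      (y := chainBoundary _ (Pi.single Finset.univ 1))
      mem_range_erase_of_chainBoundary_single_univ_ne_zero ?_ (chainBoundary_chainBoundary _)
    · intro h
      have := congrFun h (DoublingTelescope.capFacet m)
      rw [DoublingTelescope.telescopeChain_capFacet] at this
      norm_num at this
    · exact Function.ne_iff.2 ⟨_, chainBoundary_single_univ_erase_ne_zero 0⟩

/-- The star with `N + 1` edges. -/
theorem exists_star (N : ℕ) :
    ∃ (V : Type) (_ : Finite V) (_ : LinearOrder V) (K : PreAbstractSimplicialComplex V),
      K.HasDimension 1 ∧ K.numSimplices 1 = N + 1 ∧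
      ∃ g₁ g₂ : ℝ, IsSpectralGap (K.laplacian 0) g₁ ∧
        IsSpectralGap (K.laplacian 1) g₂ ∧ g₁ ≤ 4 ∧ g₂ ≤ 4 := by
  let f : Fin (N + 1) → Finset (Fin (N + 2)) := fun i => {0, i.succ}
  have hf : ∀ i, (f i).card = 1 + 1 := fun i => Finset.card_pair (Fin.succ_ne_zero i).symm
  have herase : ∀ i, (f i).erase 0 = {i.succ} := fun i =>
    Finset.erase_insert (by simp [(Fin.succ_ne_zero i).symm])
  have hsub : ∀ i j, (f i).erase 0 ⊆ f j → j = i := by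
    intro i j h
    rw [herase, Finset.singleton_subset_iff] at h
    simp only [f, Finset.mem_insert, Finset.mem_singleton, Fin.succ_ne_zero, false_or,
      Fin.succ_inj] at h
    exact h.symm
  have hinj : Function.Injective f := fun i j h =>
    hsub j i (by rw [h]; exact Finset.erase_subset _ _)
  refine ⟨Fin (N + 2), inferInstance, inferInstance, ofFacets f, hasDimension_ofFacets hf, ?_, ?_⟩
  · rw [numSimplices_ofFacets hf, ← Nat.card_coe_set_eq, Nat.card_range_of_injective hinj,
      Nat.card_fin]
  -- No two edges share a leaf, so all can be removed at once and a constant rank suffices. The test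
  -- chain is a single edge.
  · refine exists_spectralGaps_ofFacets_le (k := 0) hf (fun _ => 0)
      (fun i => ⟨0, by simp [f], fun j hj => Or.inl (by rw [hsub i j hj])⟩)
      (x := Pi.single (f 0) 1) ?_ ?_ ?_
    · intro s hs
      refine ⟨0, ?_⟩
      by_contra hne
      exact hs (by simp [Ne.symm hne])
    · exact Function.ne_iff.2 ⟨f 0, by simp⟩
    · rw [sum_single_sq, chainBoundary_single_pair (Fin.succ_pos 0)]
      calc ∑ s, ((Pi.single {Fin.succ 0} 1 - Pi.single {0} 1 : Finset (Fin (N + 2)) → ℝ) s) ^ 2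
          ≤ ∑ s, 2 * ((Pi.single {Fin.succ 0} 1 : Finset (Fin (N + 2)) → ℝ) s ^ 2 +
            (Pi.single {0} 1 : Finset (Fin (N + 2)) → ℝ) s ^ 2) := by
            refine Finset.sum_le_sum fun s _ => ?_
            rw [Pi.sub_apply]
            generalize (Pi.single {Fin.succ 0} 1 : Finset (Fin (N + 2)) → ℝ) s = p
            generalize (Pi.single {0} 1 : Finset (Fin (N + 2)) → ℝ) s = q
            nlinarith [sq_nonneg (p + q)]
        _ = 4 * 1 := by
            rw [← Finset.mul_sum, Finset.sum_add_distrib, sum_single_sq, sum_single_sq]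
            norm_num

end PreAbstractSimplicialComplex

/-! ### Choice of the constants -/

theorem theorem5 :
    ∃ a b C : ℝ, 0 < a ∧ 0 < b ∧ 0 < C ∧
      ∀ d : ℕ, 1 ≤ d →
        ∃ c : ℝ, 1 ≤ c ∧ (2 ≤ d → 1 < c) ∧
          ∀ n : ℕ, 1 ≤ n →
            ∃ (V : Type) (_ : Finite V) (_ : LinearOrder V) (K : PreAbstractSimplicialComplex V),
              K.HasDimension d ∧
              a * (((d : ℝ) + 1) ^ 3 * n) ≤ K.numSimplices d ∧
              (K.numSimplices d : ℝ) ≤ b * (((d : ℝ) + 1) ^ 3 * n) ∧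
              ∃ g₁ g₂ : ℝ,
                IsSpectralGap (K.laplacian (d - 1)) g₁ ∧
                IsSpectralGap (K.laplacian d) g₂ ∧
                g₁ ≤ C / c ^ K.numSimplices d ∧
                g₂ ≤ C / c ^ K.numSimplices d := by
  -- With `d = l + 2`: `1 / 3` comes from `l + 1 ≥ (l + 3) / 3`, `10` from `9 * m + 1 ≤ 10 * m`, and
  -- `9` from the numerator of the Rayleigh bound.
  refine ⟨1 / 3, 10, 9, by norm_num, by norm_num, by norm_num, fun d hd => ?_⟩
  obtain rfl | ⟨l, rfl⟩ : d = 1 ∨ ∃ l, d = 1 + l + 1 := by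
    rcases Nat.lt_or_ge d 2 with h | h
    · left; omega
    · exact Or.inr ⟨d - 2, by omega⟩
  -- For `d = 1` and `c = 1` the gaps need only be at most `9`; the star has `8 * n = (d + 1)³ n`
  -- edges.
  · refine ⟨1, le_rfl, fun h => absurd h (by norm_num), fun n hn => ?_⟩
    obtain ⟨V, hV, hV', K, hK, hcard, g₁, g₂, h₁, h₂, hg₁, hg₂⟩ :=
      PreAbstractSimplicialComplex.exists_star (8 * n - 1)
    have hcard' : (K.numSimplices 1 : ℝ) = 8 * n := by
      rw [hcard, Nat.sub_add_cancel (by omega)]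
      push_cast
      ring
    have hn' : (0 : ℝ) ≤ n := Nat.cast_nonneg n
    refine ⟨V, hV, hV', K, hK, ?_, ?_, g₁, g₂, h₁, h₂, ?_, ?_⟩
    · rw [hcard']; push_cast; linarith
    · rw [hcard']; push_cast; linarith
    · rw [one_pow]; linarith
    · rw [one_pow]; linarith
  -- Chosen so that the bound `10 * (l + 1) * m` on the number of facets gives `c ^ n_d ≤ 4 ^ m`.
  · set c : ℝ := 4 ^ (1 / ((10 * (l + 1) : ℕ) : ℝ)) with hc
    have hc1 : 1 < c := Real.one_lt_rpow (by norm_num) (by positivity)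
    have hcpow : c ^ (10 * (l + 1)) = 4 := by
      rw [hc, one_div, Real.rpow_inv_natCast_pow (by norm_num) (by omega)]
    refine ⟨c, hc1.le, fun _ => hc1, fun n hn => ?_⟩
    set m := (l + 3) ^ 2 * n with hm
    have hm1 : 1 ≤ m := Nat.mul_pos (by positivity) hn
    obtain ⟨V, hV, hV', K, hK, hlow, hup, g₁, g₂, h₁, h₂, hg₁, hg₂⟩ :=
      PreAbstractSimplicialComplex.exists_telescope_join l m
    have hup' : K.numSimplices (1 + l + 1) ≤ 10 * (l + 1) * m := by
      refine hup.trans ?_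
      calc (9 * m + 1) * (l + 1) ≤ (10 * m) * (l + 1) := Nat.mul_le_mul_right _ (by omega)
        _ = _ := by ring
    have hgap : (9 : ℝ) / 4 ^ m ≤ 9 / c ^ K.numSimplices (1 + l + 1) := by
      gcongr
      calc c ^ K.numSimplices (1 + l + 1) ≤ c ^ (10 * (l + 1) * m) :=
            pow_le_pow_right₀ hc1.le hup'
        _ = 4 ^ m := by rw [pow_mul, hcpow]
    have hm' : (m : ℝ) = ((l : ℝ) + 3) ^ 2 * n := by rw [hm]; push_cast; ring
    have hpos : (0 : ℝ) ≤ ((l : ℝ) + 3) ^ 2 * n := by positivity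
    refine ⟨V, hV, hV', K, hK, ?_, ?_, g₁, g₂, h₁, h₂, hg₁.trans hgap, hg₂.trans hgap⟩
    · have h : ((m * (l + 1) : ℕ) : ℝ) ≤ K.numSimplices (1 + l + 1) := Nat.cast_le.2 hlow
      refine le_trans ?_ h
      push_cast
      rw [hm']
      nlinarith [mul_nonneg hpos (Nat.cast_nonneg (α := ℝ) l)]
    · have h : (K.numSimplices (1 + l + 1) : ℝ) ≤ ((10 * (l + 1) * m : ℕ) : ℝ) :=
        Nat.cast_le.2 hup'
      refine h.trans ?_
      push_cast
      rw [hm']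
      nlinarith [mul_nonneg hpos (Nat.cast_nonneg (α := ℝ) l)]
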